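/- For a finite list of constraints $q_1=0,\dots,q_m=0$, where the $q_l$ are real polynomials in finitely many pairs of twin variables $x_a,\bar x_a$ ($a\in A$), an SOS refutation is a polynomial identity \[ -1=\sum_{i=1}^{k} r_i^2+\sum_{l=1}^{m} t_l q_l+\sum_{a\in A}\bigl(u_a(x_a^2-x_a)+v_a(x_a+\bar x_a-1)\bigr) \] with $k\ge 0$ and arbitrary real polynomials $r_i,t_l,u_a,v_a$. Its explicit monomials are all the monomials that appear in the polynomials $r_i$, $t_l$, $q_l$, $u_a$, $v_a$, $x_a^2-x_a$ and $x_a+\bar x_a-1$, and its coefficients are the coefficients of the polynomials $r_i,t_l,u_a,v_a$. For $n\ge 1$ take the pairs of twin variables $x_{ij},\bar x_{ij}$ with $1\le i\le n$ and $1\le j\le 2n$, put $\mathrm{ks}_i=\sum_{j=1}^{2n}x_{ij}-n$, and let $Q_n$ consist of the constraints \[ \mathrm{ks}_1-\tfrac12=0,\qquad \mathrm{ks}_i^2-\mathrm{ks}_{i+1}=0\ \ (1\le i\le n-1),\qquad \mathrm{ks}_n^2=0 . \] Theorem. There is a constant $c>0$ such that, for all sufficiently large $n$, every SOS refutation of $Q_n$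 has at least $2^{cn}$ distinct explicit monomials or contains a coefficient of absolute value at least $2^{2^n}/2^{cn}$. -/

import Mathlib

namespace SOS

/-- Real polynomials in the pairs of twin variables `x a`, `x̄ a`, for `a : ι`. -/
abbrev Poly (ι : Type*) := MvPolynomial (ι ⊕ ι) ℝ

/-- Monomials in the twin variables, given by their exponents. -/
abbrev Mono (ι : Type*) := (ι ⊕ ι) →₀ ℕ

/-- The variable `x a`. -/
noncomputable def x {ι : Type*} (a : ι) : Poly ι := MvPolynomial.X (Sum.inl a)

/-- The twin variable `x̄ a`, intended to stand for `1 - x a`. -/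
noncomputable def xbar {ι : Type*} (a : ι) : Poly ι := MvPolynomial.X (Sum.inr a)

/-- The logical axiom `x a ^ 2 - x a`. -/
noncomputable def boolAxiom {ι : Type*} (a : ι) : Poly ι := x a ^ 2 - x a

/-- The logical axiom `x a + x̄ a - 1`. -/
noncomputable def twinAxiom {ι : Type*} (a : ι) : Poly ι := x a + xbar a - 1

/-- A Sums-of-Squares proof of non-negativity of `p` from the constraints `q l = 0`, `l : Fin m`:
a polynomial identity
`p = ∑ i, (r i)² + ∑ l, t l * q l + ∑ a, (u a * (x a ² - x a) + v a * (x a + x̄ a - 1))`. -/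
structure Proof {ι : Type*} [Fintype ι] {m : ℕ} (q : Fin m → Poly ι) (p : Poly ι) where
  /-- the number of squares -/
  k : ℕ
  /-- the polynomials that are squared -/
  r : Fin k → Poly ι
  /-- the lifts of the non-logical axioms -/
  t : Fin m → Poly ι
  /-- the lifts of the logical axioms `x a ^ 2 - x a` -/
  u : ι → Poly ι
  /-- the lifts of the logical axioms `x a + x̄ a - 1` -/
  v : ι → Poly ι
  identity : p = ∑ i, r i ^ 2 + ∑ l, t l * q l + ∑ a, (u a * boolAxiom a + v a * twinAxiom a)

/-- A refutation of the constraints `q l = 0` is a proof of non-negativity of `-1` from them. -/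
abbrev Refutation {ι : Type*} [Fintype ι] {m : ℕ} (q : Fin m → Poly ι) := Proof q (-1)

open Classical in
/-- The (distinct) explicit monomials of a proof: all the monomials appearing in the polynomials
`r i`, `t l`, `q l`, `u a`, `v a`, `x a ^ 2 - x a` and `x a + x̄ a - 1`. -/
noncomputable def Proof.explicitMonomials {ι : Type*} [Fintype ι] {m : ℕ} {q : Fin m → Poly ι}
    {p : Poly ι} (π : Proof q p) : Finset (Mono ι) :=
  (Finset.univ.biUnion fun i => (π.r i).support) ∪
  (Finset.univ.biUnion fun l => (π.t l).support ∪ (q l).support) ∪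
  (Finset.univ.biUnion fun a => (π.u a).support ∪ (π.v a).support ∪
    (boolAxiom a).support ∪ (twinAxiom a).support)

/-- The real number `b` is a coefficient of one of the polynomials `r i`, `t l`, `u a`, `v a`
that make up the proof. (The axioms themselves are not counted here.) -/
def Proof.HasCoeff {ι : Type*} [Fintype ι] {m : ℕ} {q : Fin m → Poly ι}
    {p : Poly ι} (π : Proof q p) (b : ℝ) : Prop :=
  ∃ f : Poly ι, ((∃ i, f = π.r i) ∨ (∃ l, f = π.t l) ∨ (∃ a, f = π.u a) ∨ (∃ a, f = π.v a)) ∧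
    ∃ μ ∈ f.support, f.coeff μ = b

/-- The polynomial `ks_i = ∑_j x_{ij} - n` in the `2n` variables of the block `i`.
The blocks are numbered from `0` to `n - 1`. -/
noncomputable def ks (n : ℕ) (i : Fin n) : Poly (Fin n × Fin (2 * n)) :=
  ∑ j : Fin (2 * n), x (i, j) - MvPolynomial.C (n : ℝ)

/-- The `n + 1` constraints of `Q_n`, as polynomials to be set to `0`, in this order:
`ks - 1/2` for the first block; then, block by block, `ks_i ^ 2 - ks_{i+1}` for each block `i`
but the last, and `ks_i ^ 2` for the last block. -/
noncomputable def Q (n : ℕ) (hn : 0 < n) : Fin (n + 1) → Poly (Fin n × Fin (2 * n)) :=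
  Fin.cons (ks n ⟨0, hn⟩ - MvPolynomial.C (1 / 2 : ℝ)) fun i : Fin n =>
    if h : (i : ℕ) + 1 < n then ks n i ^ 2 - ks n ⟨(i : ℕ) + 1, h⟩ else ks n i ^ 2

end SOS

namespace SOS

open Finset

/-! The constraints other than the last force `ks_i = eps i`, where `eps i = 2^(-2^i)` with blocks
numbered from 0, so the last constraint fails only by `eps n = 2^(-2^n)`. Suppose a linear
functional `E` has `E 1 = 1`, is nonnegative on the squares of the proof, kills the logical axioms
and all other lifted constraints, and sends `t * ks²` of the last block to `eps n * E t`. Applied to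
the refutation it gives `-E t ≥ 2^(2^n)` for the lift `t` of the last constraint. If moreover `|E|`
is at most 1 on monomials, the coefficients of `t` have absolute sum at least `2^(2^n)`. With fewer
than `2^(cn)` monomials, one of them is large.

Such an `E` exists in low degree: it is a product over the blocks of knapsack pseudo-expectations,
which pretend that a block has a non-integral number `r` of ones (`pexp_mul_level`,
`pexp_sq_nonneg`). The Schur product theorem carries positivity to the product, so only the degree
within each block matters (`prodExp_sq_nonneg`).

A random balanced restriction, the same in every block, reduces to low degree: a monomial of large
degree in some block is killed with probability exponentially close to 1, and a union bound handles
all (monomial, block) pairs (`exists_restriction`). Balance makes the restricted blocks smaller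
knapsacks with the same `eps i`. -/

/-! ### Moments of the knapsack pseudo-distribution -/

/-- The pseudo-probability that `a` given bits are `1` and `b` other given bits are `0`, for
`r + q` bits whose sum is `r`. -/
noncomputable def moment (r q : ℝ) (a b : ℕ) : ℝ :=
  (∏ i ∈ range a, (r - i)) * (∏ i ∈ range b, (q - i)) / ∏ i ∈ range (a + b), (r + q - i)

@[simp] lemma moment_zero (r q : ℝ) : moment r q 0 0 = 1 := by simp [moment]

lemma moment_succ_left (r q : ℝ) (a b : ℕ) :
    moment r q (a + 1) b = moment r q a b * ((r - a) / (r + q - (a + b : ℕ))) := by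
  unfold moment
  rw [show a + 1 + b = a + b + 1 by ring, prod_range_succ, prod_range_succ, div_mul_div_comm]
  ring

lemma moment_succ_right (r q : ℝ) (a b : ℕ) :
    moment r q a (b + 1) = moment r q a b * ((q - b) / (r + q - (a + b : ℕ))) := by
  unfold moment
  rw [show a + (b + 1) = a + b + 1 by ring, prod_range_succ, prod_range_succ, div_mul_div_comm]
  ring

lemma moment_eq_add {r q : ℝ} {a b : ℕ} (h : r + q ≠ (a + b : ℕ)) :
    moment r q a b = moment r q (a + 1) b + moment r q a (b + 1) := by
  have h' : r + q - (a + b : ℕ) ≠ 0 := sub_ne_zero.2 h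
  rw [moment_succ_left, moment_succ_right, ← mul_add, ← add_div,
    show r - a + (q - b) = r + q - (a + b : ℕ) by push_cast; ring, div_self h', mul_one]

lemma moment_mem_Icc {r q : ℝ} {a b : ℕ} (ha : (a : ℝ) ≤ r) (hb : (b : ℝ) ≤ q) :
    moment r q a b ∈ Set.Icc (0 : ℝ) 1 := by
  have hmul : ∀ {s t : ℝ}, s ∈ Set.Icc (0 : ℝ) 1 → t ∈ Set.Icc (0 : ℝ) 1 →
      s * t ∈ Set.Icc (0 : ℝ) 1 := fun hs ht =>
    ⟨mul_nonneg hs.1 ht.1, mul_le_one₀ hs.2 ht.1 ht.2⟩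
  have hdiv : ∀ {s t : ℝ}, 0 ≤ s → s ≤ t → s / t ∈ Set.Icc (0 : ℝ) 1 := fun hs hst =>
    ⟨div_nonneg hs (hs.trans hst), div_le_one_of_le₀ hst (hs.trans hst)⟩
  induction a with
  | zero =>
    induction b with
    | zero => simp
    | succ b ih =>
      push_cast at hb ha
      rw [moment_succ_right]
      refine hmul (ih (by linarith)) (hdiv (by linarith) ?_)
      push_cast; linarith
  | succ a ih =>
    push_cast at ha
    rw [moment_succ_left]
    refine hmul (ih (by linarith)) (hdiv (by linarith) ?_)
    push_cast; linarith

variable {α : Type*} [DecidableEq α]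

/-- Split on the bits of `I` one at a time; `J` collects those that are 0. The bound by `N` keeps
the denominators nonzero. -/
lemma moment_eq_sum_powerset {r q : ℝ} {N : ℕ} (hN : r + q = N) (I : Finset α) (a b : ℕ)
    (h : a + b + #I ≤ N) :
    moment r q a b = ∑ J ∈ I.powerset, moment r q (a + #(I \ J)) (b + #J) := by
  induction I using Finset.induction_on generalizing a b with
  | empty => simp
  | insert j I hj ih =>
    rw [card_insert_of_notMem hj] at h
    rw [sum_powerset_insert hj, moment_eq_add (by rw [hN]; exact_mod_cast (by omega)),
      ih _ _ (by omega), ih a (b + 1) (by omega)]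
    congr 1
    · refine sum_congr rfl fun J hJ => ?_
      have : j ∉ J := fun hh => hj (mem_powerset.1 hJ hh)
      rw [insert_sdiff_of_notMem _ this, card_insert_of_notMem (by simp [hj])]
      congr 1; ring
    · refine sum_congr rfl fun J hJ => ?_
      have : j ∉ J := fun hh => hj (mem_powerset.1 hJ hh)
      rw [card_insert_of_notMem this, insert_sdiff_insert, sdiff_insert_of_notMem hj]
      congr 1; ring

/-! ### The pseudo-expectation of a single block -/

/-- The indicator of the subcube `A ⊆ y`, `y ∩ B = ∅`, as a function of the set `y` of the
bits that are `1`. -/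
def cube (A B : Finset α) (y : Finset α) : ℝ := if A ⊆ y ∧ Disjoint B y then 1 else 0

lemma cube_mul (A B A' B' : Finset α) : cube A B * cube A' B' = cube (A ∪ A') (B ∪ B') := by
  ext y
  simp only [Pi.mul_apply, cube, union_subset_iff, disjoint_union_left, ← ite_and, mul_ite, mul_one,
    mul_zero]
  congr 1
  apply propext
  tauto

lemma cube_eq_zero {A B : Finset α} (h : ¬ Disjoint A B) : cube A B = 0 := by
  ext y
  refine if_neg fun hy => h ?_
  exact (hy.2.mono_right hy.1).symm

/-- The knapsack pseudo-expectation, for the bits indexed by `F`. -/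
noncomputable def pexp (r q : ℝ) (F : Finset α) : (Finset α → ℝ) →ₗ[ℝ] ℝ where
  toFun f := ∑ y ∈ F.powerset, moment r q #y #(F \ y) * f y
  map_add' f g := by simp [mul_add, sum_add_distrib]
  map_smul' c f := by simp [mul_sum, mul_left_comm]

lemma pexp_apply (r q : ℝ) (F : Finset α) (f : Finset α → ℝ) :
    pexp r q F f = ∑ y ∈ F.powerset, moment r q #y #(F \ y) * f y := rfl

/-- The weights on complete assignments may be negative, but their marginals on subcubes are again
moments: summing out the undecided bits is `moment_eq_sum_powerset`. -/
lemma pexp_cube {r q : ℝ} {F A B : Finset α} (hF : r + q = #F) (hA : A ⊆ F) (hB : B ⊆ F)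
    (hAB : Disjoint A B) : pexp r q F (cube A B) = moment r q #A #B := by
  have hcard : #A + #B + #(F \ (A ∪ B)) = #F := by
    rw [← card_union_of_disjoint hAB, add_comm, card_sdiff_add_card_eq_card (union_subset hA hB)]
  rw [moment_eq_sum_powerset hF (F \ (A ∪ B)) _ _ hcard.le, pexp_apply]
  simp only [cube, mul_ite, mul_one, mul_zero]
  rw [← sum_filter]
  -- An assignment in the subcube corresponds to the set of undecided bits that it sets to 0.
  refine sum_bij' (fun y _ => (F \ B) \ y) (fun J _ => (F \ B) \ J) ?_ ?_ ?_ ?_ ?_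
  · intro y hy
    simp only [mem_filter, mem_powerset] at hy ⊢
    intro x; simp only [mem_sdiff, mem_union]
    have := @hy.2.1 x
    tauto
  · intro J hJ
    simp only [mem_filter, mem_powerset] at hJ ⊢
    refine ⟨sdiff_subset.trans sdiff_subset, fun x hx => ?_, ?_⟩
    · have h1 := @hJ x
      have h2 := disjoint_left.1 hAB hx
      have h3 := hA hx
      simp only [mem_sdiff, mem_union] at h1 ⊢
      tauto
    · exact disjoint_sdiff.mono_right sdiff_subset
  · intro y hy
    simp only [mem_filter, mem_powerset] at hy
    exact Finset.sdiff_sdiff_eq_self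
      (subset_sdiff.2 ⟨hy.1, hy.2.2.symm⟩)
  · intro J hJ
    refine Finset.sdiff_sdiff_eq_self ((mem_powerset.1 hJ).trans ?_)
    exact sdiff_subset_sdiff (subset_refl _) subset_union_right
  · intro y hy
    simp only [mem_filter, mem_powerset] at hy
    obtain ⟨hyF, hAy, hBy⟩ := hy
    congr 1
    · rw [← card_union_of_disjoint]
      · congr 1
        ext x
        have h1 := @hyF x; have h2 := @hAy x; have h3 : x ∈ B → x ∉ y := fun h => disjoint_left.1 hBy h
        simp only [mem_sdiff, mem_union]
        tauto
      · rw [disjoint_left]; intro x; simp only [mem_sdiff, mem_union]; tauto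
    · rw [← card_union_of_disjoint]
      · congr 1
        ext x
        have h1 := @hB x; have h3 : x ∈ B → x ∉ y := fun h => disjoint_left.1 hBy h
        simp only [mem_sdiff, mem_union]
        tauto
      · rw [disjoint_left]; intro x; simp only [mem_sdiff]; tauto

lemma abs_pexp_cube_le {r q : ℝ} {F A B : Finset α} {d : ℕ} (hF : r + q = #F) (hr : (d : ℝ) ≤ r)
    (hq : (d : ℝ) ≤ q) (hA : A ⊆ F) (hB : B ⊆ F) (hd : #(A ∪ B) ≤ d) :
    |pexp r q F (cube A B)| ≤ 1 := by
  by_cases hAB : Disjoint A B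
  · have h1 : (#A : ℝ) ≤ d := by exact_mod_cast (card_le_card subset_union_left).trans hd
    have h2 : (#B : ℝ) ≤ d := by exact_mod_cast (card_le_card subset_union_right).trans hd
    rw [pexp_cube hF hA hB hAB]
    have := moment_mem_Icc (h1.trans hr) (h2.trans hq)
    rw [abs_of_nonneg this.1]
    exact this.2
  · simp [cube_eq_zero hAB]

/-- The number of bits in `F` that are `1`. -/
noncomputable def level (F : Finset α) : Finset α → ℝ := fun y => (#(y ∩ F) : ℝ)

lemma level_eq_sum (F : Finset α) : level F = ∑ j ∈ F, cube {j} ∅ := by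
  ext y
  simp [level, cube, Finset.sum_apply, inter_comm]

/-- The functions of degree at most `d` in the bits of `F`. -/
noncomputable def lowDegree (F : Finset α) (d : ℕ) : Submodule ℝ (Finset α → ℝ) :=
  Submodule.span ℝ {f | ∃ S, S ⊆ F ∧ #S ≤ d ∧ f = cube S ∅}

lemma cube_empty_mem_lowDegree {F S : Finset α} {d : ℕ} (hS : S ⊆ F) (hd : #S ≤ d) :
    cube S ∅ ∈ lowDegree F d := Submodule.subset_span ⟨S, hS, hd, rfl⟩

lemma cube_mem_lowDegree {F A B : Finset α} {d : ℕ} (hA : A ⊆ F) (hB : B ⊆ F)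
    (hd : #(A ∪ B) ≤ d) : cube A B ∈ lowDegree F d := by
  induction B using Finset.induction_on generalizing A with
  | empty => exact cube_empty_mem_lowDegree hA (by simpa using hd)
  | insert j B hj ih =>
    have hB' := insert_subset_iff.1 hB
    have : cube A (insert j B) = cube A B - cube (insert j A) B := by
      ext y
      simp only [cube, Pi.sub_apply, disjoint_insert_left, insert_subset_iff]
      split_ifs <;> first | tauto | simp
    rw [this]
    refine sub_mem (ih hA hB'.2 ((card_le_card ?_).trans hd))
      (ih (insert_subset hB'.1 hA) hB'.2 ((card_le_card ?_).trans hd))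
    · exact union_subset_union_right (subset_insert _ _)
    · rw [insert_union, union_insert]

lemma mul_mem_lowDegree {F : Finset α} {d e : ℕ} {f g : Finset α → ℝ} (hf : f ∈ lowDegree F d)
    (hg : g ∈ lowDegree F e) : f * g ∈ lowDegree F (d + e) := by
  have h := Submodule.mul_mem_mul hf hg
  rw [lowDegree, lowDegree, Submodule.span_mul_span] at h
  refine Submodule.span_mono ?_ h
  rintro _ ⟨_, ⟨S, hS, hd, rfl⟩, _, ⟨T, hT, he, rfl⟩, rfl⟩
  refine ⟨S ∪ T, union_subset hS hT, (card_union_le _ _).trans (by omega), ?_⟩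
  simp [cube_mul]

lemma one_mem_lowDegree (F : Finset α) (d : ℕ) : (1 : Finset α → ℝ) ∈ lowDegree F d := by
  have : (1 : Finset α → ℝ) = cube ∅ ∅ := by ext; simp [cube]
  rw [this]
  exact cube_empty_mem_lowDegree (empty_subset _) (by simp)

lemma level_mem_lowDegree (F : Finset α) : level F ∈ lowDegree F 1 := by
  rw [level_eq_sum]
  exact sum_mem fun j hj => cube_empty_mem_lowDegree (by simpa using hj) (by simp)

lemma cube_mul_level {F S : Finset α} (hS : S ⊆ F) :
    cube S ∅ * level F = (#S : ℝ) • cube S ∅ + ∑ j ∈ F \ S, cube (insert j S) ∅ := by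
  rw [level_eq_sum, mul_sum, ← sum_sdiff hS, add_comm]
  congr 1
  · rw [sum_congr rfl (g := fun _ => cube S ∅), sum_const, Nat.cast_smul_eq_nsmul]
    intro j hj
    rw [cube_mul, empty_union, union_eq_left.2 (by simpa using hj)]
  · refine sum_congr rfl fun j _ => ?_
    rw [cube_mul, empty_union, union_comm, insert_eq]

/-- On the monomial of `S`, each of the `#F - #S` new bits multiplies the moment by `(r - #S) / (#F
- #S)`, and the bits already in `S` contribute `#S`: in total `r`. -/
lemma pexp_mul_level {r q : ℝ} {F : Finset α} {d : ℕ} (hF : r + q = #F) (hd : d < #F)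
    {f : Finset α → ℝ} (hf : f ∈ lowDegree F d) :
    pexp r q F (f * level F) = r * pexp r q F f := by
  refine Submodule.span_induction ?_ ?_ ?_ ?_ hf
  · rintro _ ⟨S, hS, hSd, rfl⟩
    have h0 : ∀ j ∈ F \ S, pexp r q F (cube (insert j S) ∅) = moment r q (#S + 1) 0 := by
      intro j hj
      rw [mem_sdiff] at hj
      rw [pexp_cube hF (insert_subset hj.1 hS) (empty_subset _) (disjoint_empty_right _),
        card_insert_of_notMem hj.2, card_empty]
    rw [cube_mul_level hS, map_add, map_smul, map_sum, sum_congr rfl h0, sum_const,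
      pexp_cube hF hS (empty_subset _) (disjoint_empty_right _), card_empty, moment_succ_left,
      card_sdiff_of_subset hS, nsmul_eq_mul, Nat.cast_sub (card_le_card hS), ← hF]
    have : r + q - (#S : ℝ) ≠ 0 := by
      rw [hF, sub_ne_zero]
      exact_mod_cast (by omega)
    simp only [smul_eq_mul, add_zero]
    field_simp
    ring
  · simp
  · intro f g _ _ h1 h2
    rw [add_mul, map_add, map_add, h1, h2, mul_add]
  · intro c f _ h
    rw [smul_mul_assoc, map_smul, map_smul, h, smul_eq_mul, smul_eq_mul, mul_left_comm]

/-- Since `#(S ∪ T) + #(S ∩ T) = 2 * d`, splitting the moment of `S ∪ T` on the bits of `S ∩ T`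
yields weights depending only on `#J`, where `J ⊆ S` and `J ⊆ T`. The quadratic form is thus a sum
of squares with weights `moment r q (2 * d - #J) #J`, nonnegative for `#J ≤ d`. -/
lemma pexp_homogeneous_sq_nonneg {r q : ℝ} {F : Finset α} {d : ℕ} (hF : r + q = #F)
    (hd : 2 * d ≤ #F) (hr : (2 * d : ℝ) ≤ r) (hq : (d : ℝ) ≤ q) (c : Finset α → ℝ) :
    0 ≤ pexp r q F ((∑ S ∈ F.powersetCard d, c S • cube S ∅) *
      (∑ S ∈ F.powersetCard d, c S • cube S ∅)) := by
  have key : ∀ S ∈ F.powersetCard d, ∀ T ∈ F.powersetCard d,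
      pexp r q F ((c S • cube S ∅) * (c T • cube T ∅)) =
      ∑ J ∈ F.powerset, moment r q (2 * d - #J) #J *
        ((if J ⊆ S then c S else 0) * (if J ⊆ T then c T else 0)) := by
    intro S hS T hT
    rw [mem_powersetCard] at hS hT
    have hc : #(S ∪ T) + #(S ∩ T) = 2 * d := by rw [card_union_add_card_inter]; omega
    rw [smul_mul_smul_comm, map_smul, cube_mul, empty_union,
      pexp_cube hF (union_subset hS.1 hT.1) (empty_subset _) (disjoint_empty_right _), card_empty,
      moment_eq_sum_powerset hF (S ∩ T) _ _ (by omega), smul_eq_mul, mul_sum]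
    have : ∀ J ∈ F.powerset, moment r q (2 * d - #J) #J *
        ((if J ⊆ S then c S else 0) * (if J ⊆ T then c T else 0)) =
        if J ⊆ S ∩ T then moment r q (2 * d - #J) #J * (c S * c T) else 0 := by
      intro J _
      simp only [subset_inter_iff]
      split_ifs <;> first | tauto | simp
    rw [sum_congr rfl this, ← sum_filter]
    refine sum_congr ?_ fun J hJ => ?_
    · ext J
      simp only [mem_powerset, mem_filter]
      exact ⟨fun h => ⟨h.trans (inter_subset_left.trans hS.1), h⟩, fun h => h.2⟩
    · have hJ' := (mem_filter.1 hJ).2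
      have h1 := card_le_card hJ'
      rw [card_sdiff_of_subset hJ', zero_add, mul_comm]
      congr 2
      omega
  have : pexp r q F ((∑ S ∈ F.powersetCard d, c S • cube S ∅) *
      (∑ S ∈ F.powersetCard d, c S • cube S ∅)) =
      ∑ J ∈ F.powerset, moment r q (2 * d - #J) #J *
        (∑ S ∈ F.powersetCard d, if J ⊆ S then c S else 0) ^ 2 := by
    rw [sum_mul_sum, map_sum]
    simp_rw [map_sum]
    rw [sum_congr rfl fun S hS => sum_congr rfl fun T hT => key S hS T hT]
    simp_rw [sq, sum_mul_sum, mul_sum]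
    rw [sum_congr rfl fun S _ => sum_comm, sum_comm]
  rw [this]
  refine sum_nonneg fun J hJ => ?_
  by_cases hJd : #J ≤ d
  · refine mul_nonneg (moment_mem_Icc (le_trans ?_ hr) (le_trans ?_ hq)).1 (sq_nonneg _)
    · exact_mod_cast Nat.sub_le _ _
    · exact_mod_cast hJd
  · rw [sum_eq_zero, zero_pow two_ne_zero, mul_zero]
    intro S hS
    refine if_neg fun h => hJd ?_
    rw [← (mem_powersetCard.1 hS).2]
    exact card_le_card h

/-- Modulo `level F = r`, a monomial `x_S` with `#S < d` equals `(r - #S)⁻¹ * ∑ x_{S ∪ {j}}` over `j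
∉ S`; iterating raises everything to degree exactly `d`. -/
lemma exists_homogeneous {r q : ℝ} {F : Finset α} {d : ℕ} (hF : r + q = #F)
    (hd : 2 * d < #F) (hr : (d : ℝ) ≤ r) {f : Finset α → ℝ} (hf : f ∈ lowDegree F d) :
    ∃ c : Finset α → ℝ, ∀ g ∈ lowDegree F d,
      pexp r q F (f * g) = pexp r q F ((∑ S ∈ F.powersetCard d, c S • cube S ∅) * g) := by
  set P : (Finset α → ℝ) → Prop := fun f => ∃ c : Finset α → ℝ, ∀ g ∈ lowDegree F d,
      pexp r q F (f * g) = pexp r q F ((∑ S ∈ F.powersetCard d, c S • cube S ∅) * g) with hP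
  have hzero : P 0 := ⟨0, fun g _ => by simp⟩
  have hadd : ∀ f g, P f → P g → P (f + g) := by
    rintro f g ⟨c, hc⟩ ⟨c', hc'⟩
    refine ⟨c + c', fun h hh => ?_⟩
    simp only [Pi.add_apply, add_smul, sum_add_distrib, add_mul, map_add, hc h hh, hc' h hh]
  have hsmul : ∀ (a : ℝ) f, P f → P (a • f) := by
    rintro a f ⟨c, hc⟩
    refine ⟨a • c, fun h hh => ?_⟩
    simp only [Pi.smul_apply, smul_assoc, ← smul_sum, smul_mul_assoc, map_smul, hc h hh]
  have hsum : ∀ (s : Finset α) (f : α → Finset α → ℝ), (∀ j ∈ s, P (f j)) → P (∑ j ∈ s, f j) :=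
    fun s f h => sum_induction f P hadd hzero h
  have hcube : ∀ k, ∀ S ⊆ F, #S + k = d → P (cube S ∅) := by
    intro k
    induction k with
    | zero =>
      intro S hS hk
      refine ⟨Pi.single S 1, fun g _ => ?_⟩
      rw [sum_eq_single_of_mem S (mem_powersetCard.2 ⟨hS, hk⟩)]
      · simp
      · intro T _ hT
        simp [hT]
    | succ k ih =>
      intro S hS hk
      have hne : r - #S ≠ 0 := by
        have : (#S : ℝ) < d := by exact_mod_cast (by omega)
        exact (by linarith : 0 < r - #S).ne'
      have h1 : P ((r - #S)⁻¹ • ∑ j ∈ F \ S, cube (insert j S) ∅) := by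
        refine hsmul _ _ (hsum _ _ fun j hj => ?_)
        rw [mem_sdiff] at hj
        refine ih _ (insert_subset hj.1 hS) ?_
        rw [card_insert_of_notMem hj.2]
        omega
      obtain ⟨c, hc⟩ := h1
      refine ⟨c, fun g hg => ?_⟩
      rw [← hc g hg]
      have h2 := pexp_mul_level hF (by omega)
        (mul_mem_lowDegree (cube_empty_mem_lowDegree hS (by omega : #S ≤ d)) hg)
      rw [mul_right_comm, cube_mul_level hS, add_mul, map_add, smul_mul_assoc, map_smul] at h2
      rw [smul_mul_assoc, map_smul, smul_eq_mul, eq_inv_mul_iff_mul_eq₀ hne]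
      rw [smul_eq_mul] at h2
      linarith
  refine Submodule.span_induction ?_ hzero (fun f g _ _ => hadd f g) (fun a f _ => hsmul a f) hf
  rintro _ ⟨S, hS, hSd, rfl⟩
  exact hcube (d - #S) S hS (by omega)

lemma pexp_sq_nonneg {r q : ℝ} {F : Finset α} {d : ℕ} (hF : r + q = #F)
    (hd : 2 * d < #F) (hr : (2 * d : ℝ) ≤ r) (hq : (d : ℝ) ≤ q) {f : Finset α → ℝ}
    (hf : f ∈ lowDegree F d) : 0 ≤ pexp r q F (f * f) := by
  have hd0 : (0 : ℝ) ≤ d := Nat.cast_nonneg d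
  obtain ⟨c, hc⟩ := exists_homogeneous hF hd (by linarith) hf
  have hmem : ∑ S ∈ F.powersetCard d, c S • cube S ∅ ∈ lowDegree F d :=
    sum_mem fun S hS => Submodule.smul_mem _ _ (cube_empty_mem_lowDegree
      (mem_powersetCard.1 hS).1 (mem_powersetCard.1 hS).2.le)
  -- Both factors are replaced in turn by the homogeneous representative.
  rw [hc f hf, mul_comm, hc _ hmem]
  exact pexp_homogeneous_sq_nonneg hF hd.le hr hq c

/-! ### Restrictions of a block -/

section Restriction

lemma prod_indicator_pow {γ : Type*} (s : Finset γ) (P : γ → Prop) [DecidablePred P] (e : γ → ℕ) :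
    ∏ j ∈ s, (if P j then (1 : ℝ) else 0) ^ e j = if ∀ j ∈ s, e j ≠ 0 → P j then 1 else 0 := by
  have h : ∀ j ∈ s, (if P j then (1 : ℝ) else 0) ^ e j = if e j ≠ 0 → P j then 1 else 0 := by
    intro j _
    by_cases he : e j = 0 <;> by_cases hp : P j <;> simp [he, hp]
  rw [prod_congr rfl h, prod_ite_zero, prod_const_one]

variable {β : Type*} [DecidableEq β]

/-- The subcube indicator after the bits in `O` are set to `1` and those outside `O ∪ F` to `0`. -/
def restrictedCube (O F A B : Finset β) : Finset β → ℝ := fun y => cube A B (O ∪ (y ∩ F))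

/-- The subcube indicator becomes zero or of degree at most `d` under the restriction. -/
def LowRestriction (O F : Finset β) (d : ℕ) (A B : Finset β) : Prop :=
  restrictedCube O F A B = 0 ∨ ∃ A' B', A' ⊆ F ∧ B' ⊆ F ∧ #(A' ∪ B') ≤ d ∧
    restrictedCube O F A B = cube A' B'

lemma LowRestriction.mem_lowDegree {O F : Finset β} {d : ℕ} {A B : Finset β}
    (h : LowRestriction O F d A B) : restrictedCube O F A B ∈ lowDegree F d := by
  obtain h | ⟨A', B', hA, hB, hd, h⟩ := h
  · rw [h]; exact zero_mem _
  · rw [h]; exact cube_mem_lowDegree hA hB hd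

lemma LowRestriction.abs_pexp_le {O F : Finset β} {d : ℕ} {A B : Finset β} {r q : ℝ}
    (h : LowRestriction O F d A B) (hF : r + q = #F) (hr : (d : ℝ) ≤ r) (hq : (d : ℝ) ≤ q) :
    |pexp r q F (restrictedCube O F A B)| ≤ 1 := by
  obtain h | ⟨A', B', hA, hB, hd, h⟩ := h
  · simp [h]
  · rw [h]; exact abs_pexp_cube_le hF hr hq hA hB hd

lemma restrictedCube_eq {O F A B : Finset β} (hOF : Disjoint O F) (hA : A ⊆ O ∪ F)
    (hB : Disjoint B O) : restrictedCube O F A B = cube (A ∩ F) (B ∩ F) := by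
  ext y
  simp only [restrictedCube, cube]
  congr 1
  apply propext
  simp only [subset_iff, disjoint_left, mem_union, mem_inter] at *
  constructor
  · rintro ⟨h1, h2⟩
    refine ⟨fun x hx => ?_, fun x hx => ?_⟩
    · have := h1 hx.1
      have := @hOF x
      tauto
    · have := h2 hx.1
      tauto
  · rintro ⟨h1, h2⟩
    refine ⟨fun x hx => ?_, fun x hx => ?_⟩
    · have := hA hx
      have := @h1 x
      tauto
    · have := hB hx
      have := @h2 x
      tauto

lemma lowRestriction_of {O F A B : Finset β} {d : ℕ} (hOF : Disjoint O F)
    (h : A ⊆ O ∪ F → Disjoint B O → #(A ∪ B) ≤ d) : LowRestriction O F d A B := by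
  by_cases hA : A ⊆ O ∪ F
  · by_cases hB : Disjoint B O
    · refine Or.inr ⟨A ∩ F, B ∩ F, inter_subset_right, inter_subset_right,
        (card_le_card ?_).trans (h hA hB), restrictedCube_eq hOF hA hB⟩
      exact union_subset_union inter_subset_left inter_subset_left
    · left
      ext y
      exact if_neg fun hy => hB (hy.2.mono_right subset_union_left)
  · left
    ext y
    exact if_neg fun hy => hA (hy.1.trans (union_subset_union_right inter_subset_right))

end Restriction

/-! ### Products of blocks -/

/-- The Schur product theorem, iterated. -/
lemma posSemidef_prod {κ I : Type*} [Finite I] (s : Finset κ) (K : κ → Matrix I I ℝ)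
    (hK : ∀ i ∈ s, (K i).PosSemidef) :
    (Matrix.of fun a b => ∏ i ∈ s, K i a b).PosSemidef := by
  classical
  have := Fintype.ofFinite I
  induction s using Finset.induction_on with
  | empty =>
    have h := Matrix.posSemidef_vecMulVec_self_star (1 : I → ℝ)
    have he : (Matrix.of fun a b => ∏ i ∈ (∅ : Finset κ), K i a b) =
        Matrix.vecMulVec (1 : I → ℝ) (star 1) := by
      ext a b
      simp [Matrix.vecMulVec_apply]
    rwa [he]
  | insert j s hj ih =>
    have h := (hK j (mem_insert_self _ _)).hadamard (ih fun i hi => hK i (mem_insert_of_mem hi))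
    have he : (Matrix.of fun a b => ∏ i ∈ insert j s, K i a b) =
        (K j).hadamard (Matrix.of fun a b => ∏ i ∈ s, K i a b) := by
      ext a b
      simp [Matrix.hadamard_apply, prod_insert hj]
    rwa [he]

variable {κ β : Type*} [Fintype κ] [DecidableEq κ] [DecidableEq β]

/-- The tensor product of the pseudo-expectations of the blocks. -/
noncomputable def prodExp (r q : κ → ℝ) (F : Finset β) :
    ((κ → Finset β) → ℝ) →ₗ[ℝ] ℝ where
  toFun f := ∑ Y ∈ Fintype.piFinset fun _ : κ => F.powerset,
    (∏ i, moment (r i) (q i) #(Y i) #(F \ Y i)) * f Y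
  map_add' f g := by simp [mul_add, sum_add_distrib]
  map_smul' c f := by simp [mul_sum, mul_left_comm]

lemma prodExp_prod (r q : κ → ℝ) (F : Finset β) (h : κ → Finset β → ℝ) :
    prodExp r q F (fun Y => ∏ i, h i (Y i)) = ∏ i, pexp (r i) (q i) F (h i) := by
  simp only [pexp_apply]
  rw [prod_univ_sum]
  simp only [prodExp, LinearMap.coe_mk, AddHom.coe_mk, prod_mul_distrib]

/-- The 0/1 assignment that sets to `1` the bits of `O`, the bits of `Y i ∩ F` in block `i`,
and no others. -/
def assignment (O F : Finset β) (Y : κ → Finset β) : (κ × β) ⊕ (κ × β) → ℝ :=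
  Sum.elim (fun a => if a.2 ∈ O ∪ (Y a.1 ∩ F) then 1 else 0)
    (fun a => if a.2 ∉ O ∪ (Y a.1 ∩ F) then 1 else 0)

/-- A polynomial as a function of the 0/1 assignments that extend a restriction. -/
noncomputable def evalFn (O F : Finset β) : Poly (κ × β) →ₐ[ℝ] ((κ → Finset β) → ℝ) :=
  AlgHom.pi fun Y => MvPolynomial.aeval (assignment O F Y)

lemma evalFn_x (O F : Finset β) (a : κ × β) (Y : κ → Finset β) :
    evalFn O F (x a) Y = if a.2 ∈ O ∪ (Y a.1 ∩ F) then 1 else 0 := by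
  simp [evalFn, x, assignment]

lemma evalFn_boolAxiom (O F : Finset β) (a : κ × β) : evalFn O F (boolAxiom a) = 0 := by
  ext Y
  rw [boolAxiom, map_sub, map_pow]
  simp only [Pi.sub_apply, Pi.pow_apply, evalFn_x, Pi.zero_apply]
  split_ifs <;> norm_num

lemma evalFn_twinAxiom (O F : Finset β) (a : κ × β) : evalFn O F (twinAxiom a) = 0 := by
  ext Y
  rw [twinAxiom, map_sub, map_add, map_one]
  simp only [Pi.sub_apply, Pi.add_apply, evalFn_x, Pi.zero_apply, Pi.one_apply]
  simp only [evalFn, xbar, assignment, AlgHom.pi_apply, MvPolynomial.aeval_X, Sum.elim_inr]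
  split_ifs <;> norm_num

variable [Fintype β]

/-- The bits of block `i` that occur in the monomial `μ`. -/
def posVars (μ : Mono (κ × β)) (i : κ) : Finset β := univ.filter fun j => μ (Sum.inl (i, j)) ≠ 0

/-- The bits of block `i` whose twins occur in the monomial `μ`. -/
def negVars (μ : Mono (κ × β)) (i : κ) : Finset β := univ.filter fun j => μ (Sum.inr (i, j)) ≠ 0

lemma evalFn_monomial (O F : Finset β) (μ : Mono (κ × β)) (c : ℝ) :
    evalFn O F (MvPolynomial.monomial μ c) =
      c • fun Y : κ → Finset β => ∏ i, restrictedCube O F (posVars μ i) (negVars μ i) (Y i) := by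
  ext Y
  simp only [evalFn, AlgHom.pi_apply, MvPolynomial.aeval_monomial, Pi.smul_apply, smul_eq_mul]
  congr 1
  rw [Finsupp.prod_fintype _ _ (fun _ => pow_zero _), Fintype.prod_sum_type,
    Fintype.prod_prod_type, Fintype.prod_prod_type, ← prod_mul_distrib]
  refine prod_congr rfl fun i _ => ?_
  simp only [assignment, Sum.elim_inl, Sum.elim_inr]
  rw [prod_indicator_pow, prod_indicator_pow, ite_zero_mul_ite_zero, mul_one]
  simp only [restrictedCube, cube]
  congr 1
  simp [posVars, negVars, subset_iff, disjoint_left]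

/-- All monomials of `p` become zero or of degree at most `d` in each block. -/
def IsTame (O F : Finset β) (d : ℕ) (p : Poly (κ × β)) : Prop :=
  ∀ μ ∈ p.support, ∀ i, LowRestriction O F d (posVars μ i) (negVars μ i)

lemma evalFn_eq_sum (O F : Finset β) (p : Poly (κ × β)) :
    evalFn O F p = ∑ μ ∈ p.support, p.coeff μ •
      fun Y : κ → Finset β => ∏ i, restrictedCube O F (posVars μ i) (negVars μ i) (Y i) := by
  conv_lhs => rw [p.as_sum, map_sum]
  exact sum_congr rfl fun μ _ => evalFn_monomial O F μ _

/-- In the monomials of `p`, the moment matrix of the product functional is the entrywise product of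
those of the blocks, each positive semidefinite by `pexp_sq_nonneg`. -/
lemma prodExp_sq_nonneg {O F : Finset β} {d : ℕ} {r q : κ → ℝ} (hF : ∀ i, r i + q i = #F)
    (hd : 2 * d < #F) (hr : ∀ i, (2 * d : ℝ) ≤ r i) (hq : ∀ i, (d : ℝ) ≤ q i)
    {p : Poly (κ × β)} (hp : IsTame O F d p) : 0 ≤ prodExp r q F (evalFn O F (p ^ 2)) := by
  set φ : p.support → κ → Finset β → ℝ :=
    fun μ i => restrictedCube O F (posVars μ.1 i) (negVars μ.1 i) with hφ
  set K : κ → Matrix p.support p.support ℝ :=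
    fun i => Matrix.of fun μ ν => pexp (r i) (q i) F (φ μ i * φ ν i) with hK
  have hpsd : ∀ i ∈ univ, (K i).PosSemidef := by
    intro i _
    refine .of_dotProduct_mulVec_nonneg ?_ fun c => ?_
    · ext μ ν
      simp [hK, mul_comm]
    · have hmem : ∑ μ, c μ • φ μ i ∈ lowDegree F d :=
        sum_mem fun μ _ => Submodule.smul_mem _ _ (hp μ.1 μ.2 i).mem_lowDegree
      have := pexp_sq_nonneg (hF i) hd (hr i) (hq i) hmem
      rw [sum_mul_sum, map_sum] at this
      refine this.trans_eq ?_
      simp only [dotProduct, Matrix.mulVec, mul_sum, map_sum]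
      refine sum_congr rfl fun μ _ => sum_congr rfl fun ν _ => ?_
      simp only [hK, Matrix.of_apply, smul_mul_smul_comm, map_smul, star_trivial, smul_eq_mul]
      ring
  have h := (posSemidef_prod univ K hpsd).dotProduct_mulVec_nonneg fun μ => p.coeff μ.1
  refine h.trans_eq ?_
  symm
  rw [map_pow, sq, evalFn_eq_sum, ← sum_coe_sort, sum_mul_sum, map_sum]
  simp only [dotProduct, Matrix.mulVec, mul_sum, map_sum]
  refine sum_congr rfl fun μ _ => sum_congr rfl fun ν _ => ?_
  rw [smul_mul_smul_comm, map_smul]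
  have : ((fun Y : κ → Finset β => ∏ i, φ μ i (Y i)) * fun Y => ∏ i, φ ν i (Y i)) =
      fun Y => ∏ i, (φ μ i * φ ν i) (Y i) := by
    ext Y
    simp [prod_mul_distrib]
  simp only [hφ] at this
  rw [this, prodExp_prod]
  simp only [hK, hφ, Matrix.of_apply, star_trivial, smul_eq_mul]
  ring

lemma abs_prodExp_le {O F : Finset β} {d : ℕ} {r q : κ → ℝ} (hF : ∀ i, r i + q i = #F)
    (hr : ∀ i, (d : ℝ) ≤ r i) (hq : ∀ i, (d : ℝ) ≤ q i)
    {p : Poly (κ × β)} (hp : IsTame O F d p) :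
    |prodExp r q F (evalFn O F p)| ≤ ∑ μ ∈ p.support, |p.coeff μ| := by
  rw [evalFn_eq_sum, map_sum]
  refine (abs_sum_le_sum_abs _ _).trans (sum_le_sum fun μ hμ => ?_)
  rw [map_smul, prodExp_prod, smul_eq_mul, abs_mul, abs_prod]
  exact mul_le_of_le_one_right (abs_nonneg _) (prod_le_one (fun i _ => abs_nonneg _)
    fun i _ => (hp μ hμ i).abs_pexp_le (hF i) (hr i) (hq i))

lemma prodExp_mul_eq_zero {O F : Finset β} {d : ℕ} {r q : κ → ℝ} {p : Poly (κ × β)}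
    (hp : IsTame O F d p) (i : κ) {g : Finset β → ℝ}
    (hg : ∀ f ∈ lowDegree F d, pexp (r i) (q i) F (f * g) = 0) :
    prodExp r q F (evalFn O F p * fun Y => g (Y i)) = 0 := by
  rw [evalFn_eq_sum, sum_mul, map_sum]
  refine sum_eq_zero fun μ hμ => ?_
  rw [smul_mul_assoc, map_smul]
  set φ : κ → Finset β → ℝ := fun i => restrictedCube O F (posVars μ i) (negVars μ i) with hφ
  have : ((fun Y : κ → Finset β => ∏ i, φ i (Y i)) * fun Y => g (Y i)) =
      fun Y => ∏ k, Function.update φ i (φ i * g) k (Y k) := by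
    ext Y
    rw [Pi.mul_apply, ← mul_prod_erase univ _ (mem_univ i),
      ← mul_prod_erase univ (fun k => Function.update φ i (φ i * g) k (Y k)) (mem_univ i),
      Function.update_self, Pi.mul_apply, mul_right_comm]
    congr 1
    refine prod_congr rfl fun k hk => ?_
    rw [Function.update_of_ne (ne_of_mem_erase hk)]
  rw [this, prodExp_prod, prod_eq_zero (mem_univ i), smul_zero]
  rw [Function.update_self]
  exact hg _ (hp μ hμ i).mem_lowDegree

/-! ### A random restriction -/

section RandomRestriction

variable {n : ℕ}

/-- The `c`-th bit of the `k`-th group of four bits. -/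
def bit (k : Fin (n / 2)) (c : Fin 4) : Fin (2 * n) := ⟨4 * k + c, by omega⟩

lemma bit_inj {k k' : Fin (n / 2)} {c c' : Fin 4} : bit k c = bit k' c' ↔ k = k' ∧ c = c' := by
  simp only [bit, Fin.ext_iff]
  omega

/-- The bits set to `1` by the restriction `ρ`: one in each group. -/
def ones (ρ : Fin (n / 2) → Fin 4) : Finset (Fin (2 * n)) := univ.image fun k => bit k (ρ k)

/-- The bits set to `0` by the restriction `ρ`: one in each group. -/
def zeros (ρ : Fin (n / 2) → Fin 4) : Finset (Fin (2 * n)) :=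
  univ.image fun k => bit k (ρ k).rev

/-- The bits left free by the restriction `ρ`. -/
def free (ρ : Fin (n / 2) → Fin 4) : Finset (Fin (2 * n)) := (ones ρ ∪ zeros ρ)ᶜ

lemma card_ones (ρ : Fin (n / 2) → Fin 4) : #(ones ρ) = n / 2 := by
  rw [ones, card_image_of_injective _ fun k k' h => (bit_inj.1 h).1, card_univ, Fintype.card_fin]

lemma card_zeros (ρ : Fin (n / 2) → Fin 4) : #(zeros ρ) = n / 2 := by
  rw [zeros, card_image_of_injective _ fun k k' h => (bit_inj.1 h).1, card_univ, Fintype.card_fin]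

lemma disjoint_ones_zeros (ρ : Fin (n / 2) → Fin 4) : Disjoint (ones ρ) (zeros ρ) := by
  rw [disjoint_left]
  intro j h1 h2
  simp only [ones, zeros, mem_image, mem_univ, true_and] at h1 h2
  obtain ⟨k, rfl⟩ := h1
  obtain ⟨k', h⟩ := h2
  obtain ⟨rfl, h⟩ := bit_inj.1 h
  have := congrArg Fin.val h
  rw [Fin.val_rev] at this
  omega

lemma card_free (ρ : Fin (n / 2) → Fin 4) : #(free ρ) + 2 * #(ones ρ) = 2 * n := by
  have := card_compl_add_card (ones ρ ∪ zeros ρ)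
  rw [card_union_of_disjoint (disjoint_ones_zeros ρ), card_ones, card_zeros, Fintype.card_fin]
    at this
  rw [free, card_ones]
  omega

lemma disjoint_ones_free (ρ : Fin (n / 2) → Fin 4) : Disjoint (ones ρ) (free ρ) :=
  disjoint_compl_right.mono_left subset_union_left

lemma disjoint_zeros_of_subset {ρ : Fin (n / 2) → Fin 4} {A : Finset (Fin (2 * n))}
    (h : A ⊆ ones ρ ∪ free ρ) : Disjoint A (zeros ρ) := by
  refine Disjoint.mono_left h (disjoint_union_left.2 ⟨disjoint_ones_zeros ρ, ?_⟩)
  exact (disjoint_compl_right.mono_left subset_union_right).symm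

lemma card_le_of_groups (C : Finset (Fin (2 * n))) :
    #C ≤ 4 * #{k : Fin (n / 2) | ∃ c, bit k c ∈ C} + 2 := by
  set T : Finset (Fin (n / 2)) := {k | ∃ c, bit k c ∈ C} with hT
  have hsub : C ⊆ (T ×ˢ (univ : Finset (Fin 4))).image (fun p => bit p.1 p.2) ∪
      ({j | 4 * (n / 2) ≤ j.val} : Finset (Fin (2 * n))) := by
    intro j hj
    rw [mem_union]
    by_cases hlt : 4 * (n / 2) ≤ j.val
    · right; simpa using hlt
    · left
      have hj' : bit ⟨j / 4, by omega⟩ ⟨j % 4, by omega⟩ = j := by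
        simp only [bit, Fin.ext_iff]
        omega
      rw [mem_image]
      refine ⟨(⟨j / 4, by omega⟩, ⟨j % 4, by omega⟩), ?_, hj'⟩
      simp only [mem_product, mem_univ, and_true, hT, mem_filter, true_and]
      exact ⟨_, hj'.symm ▸ hj⟩
  have hrest : #({j | 4 * (n / 2) ≤ j.val} : Finset (Fin (2 * n))) ≤ 2 := by
    have : #({j | 4 * (n / 2) ≤ j.val} : Finset (Fin (2 * n))) ≤ #(Ico (4 * (n / 2)) (2 * n)) := by
      refine card_le_card_of_injOn Fin.val (fun j hj => ?_) (Fin.val_injective.injOn)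
      simp only [coe_filter, mem_univ, true_and, Set.mem_ofPred_eq] at hj
      simp only [coe_Ico, Set.mem_Ico]
      exact ⟨hj, j.2⟩
    rw [Nat.card_Ico] at this
    omega
  calc #C ≤ _ := card_le_card hsub
    _ ≤ _ := card_union_le _ _
    _ ≤ #T * 4 + 2 := by
      refine add_le_add (card_image_le.trans ?_) hrest
      rw [card_product, card_univ, Fintype.card_fin]
    _ = _ := by ring

/-- In every group that the monomial touches, at least one of the four values of `ρ` falsifies one
of its literals. -/
lemma card_surviving_le {A B : Finset (Fin (2 * n))} {t : ℕ} (h : 4 * t < #(A ∪ B)) :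
    (#{ρ : Fin (n / 2) → Fin 4 | Disjoint A (zeros ρ) ∧ Disjoint B (ones ρ)} : ℝ) ≤
      4 ^ (n / 2) * (3 / 4) ^ t := by
  set T : Finset (Fin (n / 2)) := {k | ∃ c, bit k c ∈ A ∪ B} with hT
  have ht : t ≤ #T := by
    have : #(A ∪ B) ≤ 4 * #T + 2 := by convert card_le_of_groups (A ∪ B)
    -- `4 * t + 1 ≤ 4 * #T + 2` still gives `t ≤ #T`: the two bits outside the groups cost nothing.
    omega
  have hw : ∀ k : Fin (n / 2), ∃ w : Fin 4, k ∈ T → ∀ ρ : Fin (n / 2) → Fin 4,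
      Disjoint A (zeros ρ) → Disjoint B (ones ρ) → ρ k ≠ w := by
    intro k
    by_cases hk : k ∈ T
    · obtain ⟨c, hc⟩ := (mem_filter.1 hk).2
      obtain hc | hc := mem_union.1 hc
      · refine ⟨c.rev, fun _ ρ hA _ hρ => disjoint_left.1 hA hc ?_⟩
        exact mem_image.2 ⟨k, mem_univ _, by rw [hρ, Fin.rev_rev]⟩
      · refine ⟨c, fun _ ρ _ hB hρ => disjoint_left.1 hB hc ?_⟩
        exact mem_image.2 ⟨k, mem_univ _, by rw [hρ]⟩
    · exact ⟨0, fun h => absurd h hk⟩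
  choose w hw using hw
  have hsub : ({ρ : Fin (n / 2) → Fin 4 | Disjoint A (zeros ρ) ∧ Disjoint B (ones ρ)} : Finset _) ⊆
      Fintype.piFinset fun k => if k ∈ T then univ.erase (w k) else univ := by
    intro ρ hρ
    rw [mem_filter] at hρ
    rw [Fintype.mem_piFinset]
    intro k
    split_ifs with hk
    · exact mem_erase.2 ⟨hw k hk ρ hρ.2.1 hρ.2.2, mem_univ _⟩
    · exact mem_univ _
  have hcard : ((#(Fintype.piFinset fun k => if k ∈ T then univ.erase (w k) else univ) : ℕ) : ℝ) =
      4 ^ (n / 2) * (3 / 4) ^ #T := by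
    have h1 : ∀ k : Fin (n / 2), ((#(if k ∈ T then univ.erase (w k) else univ) : ℕ) : ℝ) =
        4 * if k ∈ T then 3 / 4 else 1 := by
      intro k
      split_ifs
      · rw [card_erase_of_mem (mem_univ _)]; norm_num
      · norm_num
    rw [Fintype.card_piFinset, Nat.cast_prod, prod_congr rfl fun k _ => h1 k, prod_mul_distrib]
    simp [div_pow]
  refine (Nat.cast_le.2 (card_le_card hsub)).trans (hcard.le.trans ?_)
  exact mul_le_mul_of_nonneg_left (pow_le_pow_of_le_one (by norm_num) (by norm_num) ht)
    (by positivity)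

lemma exists_restriction (S : Finset (Finset (Fin (2 * n)) × Finset (Fin (2 * n)))) (t : ℕ)
    (hS : (#S : ℝ) * (3 / 4) ^ t < 1) :
    ∃ ρ : Fin (n / 2) → Fin 4, ∀ P ∈ S, LowRestriction (ones ρ) (free ρ) (4 * t) P.1 P.2 := by
  by_contra! hcon
  set surv : Finset (Fin (2 * n)) × Finset (Fin (2 * n)) → Finset (Fin (n / 2) → Fin 4) :=
    fun P => {ρ | Disjoint P.1 (zeros ρ) ∧ Disjoint P.2 (ones ρ)} with hsurv
  have hcover : (univ : Finset (Fin (n / 2) → Fin 4)) ⊆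
      (S.filter fun P => 4 * t < #(P.1 ∪ P.2)).biUnion surv := by
    intro ρ _
    obtain ⟨P, hP, hlow⟩ := hcon ρ
    have : ¬ (P.1 ⊆ ones ρ ∪ free ρ → Disjoint P.2 (ones ρ) → #(P.1 ∪ P.2) ≤ 4 * t) :=
      fun h => hlow (lowRestriction_of (disjoint_ones_free ρ) h)
    push Not at this
    obtain ⟨hA, hB, hd⟩ := this
    exact mem_biUnion.2 ⟨P, mem_filter.2 ⟨hP, hd⟩,
      mem_filter.2 ⟨mem_univ _, disjoint_zeros_of_subset hA, hB⟩⟩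
  have h1 : (#(univ : Finset (Fin (n / 2) → Fin 4)) : ℝ) = 4 ^ (n / 2) := by simp
  have h2 : (#((S.filter fun P => 4 * t < #(P.1 ∪ P.2)).biUnion surv) : ℝ) ≤
      #S * (4 ^ (n / 2) * (3 / 4) ^ t) := by
    calc (#((S.filter fun P => 4 * t < #(P.1 ∪ P.2)).biUnion surv) : ℝ)
        ≤ ∑ P ∈ S.filter fun P => 4 * t < #(P.1 ∪ P.2), (#(surv P) : ℝ) := by
          exact_mod_cast card_biUnion_le
      _ ≤ ∑ P ∈ S.filter fun P => 4 * t < #(P.1 ∪ P.2), 4 ^ (n / 2) * (3 / 4) ^ t :=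
          sum_le_sum fun P hP => card_surviving_le (mem_filter.1 hP).2
      _ ≤ #S * (4 ^ (n / 2) * (3 / 4) ^ t) := by
          rw [sum_const, nsmul_eq_mul]
          refine mul_le_mul_of_nonneg_right ?_ (by positivity)
          exact_mod_cast card_filter_le _ _
  have h3 : (4 : ℝ) ^ (n / 2) ≤ #S * (4 ^ (n / 2) * (3 / 4) ^ t) := by
    rw [← h1]
    exact (Nat.cast_le.2 (card_le_card hcover)).trans (h1 ▸ h2)
  have h4 : (0 : ℝ) < 4 ^ (n / 2) := by positivity
  nlinarith

end RandomRestriction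

lemma exists_union_bound : ∃ N : ℕ, ∀ n : ℕ, N ≤ n →
    (n : ℝ) * (2 : ℝ) ^ ((1 / 200 : ℝ) * n) * (3 / 4) ^ (n / 32) < 1 := by
  have hlim := (tendsto_self_mul_const_pow_of_lt_one (r := (27 / 32 : ℝ)) (by norm_num)
    (by norm_num)).const_mul 36
  have hlim2 := (tendsto_pow_atTop_nhds_zero_of_lt_one (r := (27 / 32 : ℝ)) (by norm_num)
    (by norm_num)).const_mul 36
  have hev := (hlim.add hlim2).eventually_lt_const (u := 1) (by norm_num)
  obtain ⟨T, hT⟩ := Filter.eventually_atTop.1 hev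
  refine ⟨32 * T, fun n hn => ?_⟩
  set t := n / 32 with ht
  have h1 := hT t (by omega)
  have hn' : (n : ℝ) ≤ 32 * (t + 1) := by exact_mod_cast (by omega)
  have h2 : (2 : ℝ) ^ ((1 / 200 : ℝ) * n) ≤ (9 / 8) ^ (t + 1) := by
    -- `n / 200 ≤ (t + 1) / 6`, and `9 / 8` is small enough that `9/8 * 3/4 = 27/32 < 1`.
    have hle : (2 : ℝ) ^ (1 / 6 : ℝ) ≤ 9 / 8 := by
      rw [one_div, Real.rpow_inv_le_iff_of_pos (by norm_num) (by norm_num) (by norm_num),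
        show (6 : ℝ) = (6 : ℕ) by norm_num, Real.rpow_natCast]
      norm_num
    calc (2 : ℝ) ^ ((1 / 200 : ℝ) * n) ≤ (2 : ℝ) ^ ((1 / 6 : ℝ) * (t + 1 : ℕ)) := by
          refine Real.rpow_le_rpow_of_exponent_le (by norm_num) ?_
          push_cast
          have : (0 : ℝ) ≤ t := Nat.cast_nonneg t
          linarith
      _ = ((2 : ℝ) ^ (1 / 6 : ℝ)) ^ (t + 1) := by
          rw [Real.rpow_mul (by norm_num), Real.rpow_natCast]
      _ ≤ (9 / 8) ^ (t + 1) := pow_le_pow_left₀ (by positivity) hle _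
  calc (n : ℝ) * (2 : ℝ) ^ ((1 / 200 : ℝ) * n) * (3 / 4) ^ t
      ≤ (32 * (t + 1)) * (9 / 8) ^ (t + 1) * (3 / 4) ^ t := by gcongr
    _ = 36 * (t * (27 / 32) ^ t) + 36 * (27 / 32) ^ t := by
        rw [show (27 / 32 : ℝ) = 9 / 8 * (3 / 4) by norm_num, mul_pow]
        ring
    _ < 1 := h1

/-! ### The knapsack constraints -/

/-- The value that the constraints force on `ks i`. -/
noncomputable def eps (i : ℕ) : ℝ := (1 / 2) ^ (2 ^ i)

lemma eps_sq (i : ℕ) : eps i ^ 2 = eps (i + 1) := by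
  rw [eps, eps, ← pow_mul, pow_succ]

lemma eps_pos (i : ℕ) : 0 < eps i := by unfold eps; positivity

lemma eps_le_half (i : ℕ) : eps i ≤ 1 / 2 := by
  unfold eps
  calc (1 / 2 : ℝ) ^ (2 ^ i) ≤ (1 / 2) ^ 1 :=
        pow_le_pow_of_le_one (by norm_num) (by norm_num) Nat.one_le_two_pow
    _ = 1 / 2 := pow_one _

lemma evalFn_ks {n : ℕ} {O F : Finset (Fin (2 * n))} (hOF : Disjoint O F) (i : Fin n)
    (Y : Fin n → Finset (Fin (2 * n))) :
    evalFn O F (ks n i) Y = #O + level F (Y i) - n := by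
  rw [ks, map_sub, map_sum, Pi.sub_apply, Finset.sum_apply]
  have h1 : evalFn O F (MvPolynomial.C (n : ℝ)) Y = n := by
    simp [evalFn]
  rw [h1]
  simp only [evalFn_x]
  rw [sum_boole, filter_mem_eq_inter, univ_inter, level,
    card_union_of_disjoint (hOF.mono_right inter_subset_right)]
  push_cast
  ring

/-- The pseudo-expectation that satisfies all the constraints but the last. -/
noncomputable def knapsackExp (n : ℕ) (O F : Finset (Fin (2 * n))) :
    Poly (Fin n × Fin (2 * n)) →ₗ[ℝ] ℝ :=
  prodExp (fun i : Fin n => (#F / 2 + eps i : ℝ)) (fun i : Fin n => (#F / 2 - eps i : ℝ)) F ∘ₗ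
    (evalFn O F).toLinearMap

section

variable {n : ℕ} {O F : Finset (Fin (2 * n))} {d : ℕ}

lemma knapsackExp_one : knapsackExp n O F 1 = 1 := by
  have h : (1 : (Fin n → Finset (Fin (2 * n))) → ℝ) = fun Y => ∏ i, cube ∅ ∅ (Y i) := by
    ext Y
    simp [cube]
  simp only [knapsackExp, LinearMap.comp_apply, AlgHom.toLinearMap_apply, map_one]
  rw [h, prodExp_prod]
  refine prod_eq_one fun i _ => ?_
  rw [pexp_cube (by ring) (empty_subset _) (empty_subset _) (disjoint_empty_left _)]
  simp

lemma knapsackExp_mul_of_evalFn_eq_zero (u p : Poly (Fin n × Fin (2 * n)))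
    (hp : evalFn O F p = 0) : knapsackExp n O F (u * p) = 0 := by
  simp [knapsackExp, hp]

lemma knapsackExp_mul_level_sub (hd : d + 1 < #F) {p : Poly (Fin n × Fin (2 * n))}
    (hp : IsTame O F d p) (i : Fin n) (a b : ℝ) :
    prodExp (fun i : Fin n => (#F / 2 + eps i : ℝ)) (fun i : Fin n => (#F / 2 - eps i : ℝ)) F
      (evalFn O F p * fun Y => (level F (Y i) - (#F / 2 + eps i)) * (a * level F (Y i) + b)) =
      0 := by
  refine prodExp_mul_eq_zero hp i
    (g := fun y => (level F y - (#F / 2 + eps i)) * (a * level F y + b)) fun f hf => ?_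
  have hg : f * (a • level F + b • 1) ∈ lowDegree F (d + 1) :=
    mul_mem_lowDegree hf (add_mem (Submodule.smul_mem _ _ (level_mem_lowDegree F))
      (Submodule.smul_mem _ _ (one_mem_lowDegree F 1)))
  have h := pexp_mul_level (r := #F / 2 + eps i) (q := #F / 2 - eps i) (by ring) hd hg
  have he : (f * fun y => (level F y - (#F / 2 + eps i)) * (a * level F y + b)) =
      f * (a • level F + b • 1) * level F - (#F / 2 + eps i : ℝ) • (f * (a • level F + b • 1)) := by
    ext y
    simp only [Pi.mul_apply, Pi.sub_apply, Pi.smul_apply, Pi.add_apply, Pi.one_apply, smul_eq_mul]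
    ring
  rw [he, map_sub, map_smul, h, smul_eq_mul, sub_self]

lemma evalFn_C (c : ℝ) (Y : Fin n → Finset (Fin (2 * n))) :
    evalFn O F (MvPolynomial.C c : Poly (Fin n × Fin (2 * n))) Y = c := by
  simp [evalFn]

lemma knapsackExp_mul_Q (hn : 0 < n) (hOF : Disjoint O F) (hcard : #F + 2 * #O = 2 * n)
    (hd : d + 1 < #F) {p : Poly (Fin n × Fin (2 * n))} (hp : IsTame O F d p)
    (l : Fin (n + 1)) :
    knapsackExp n O F (p * Q n hn l) =
      if l = Fin.last n then eps n * knapsackExp n O F p else 0 := by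
  have hO : (#O : ℝ) - n = - (#F / 2) := by
    have : (#F : ℝ) + 2 * #O = 2 * n := by exact_mod_cast hcard
    linarith
  have hks : ∀ (i : Fin n) (Y : Fin n → Finset (Fin (2 * n))),
      evalFn O F (ks n i) Y = level F (Y i) - (#F / 2 + eps i) + eps i := by
    intro i Y
    rw [evalFn_ks hOF]
    linarith
  have hlin := fun i => knapsackExp_mul_level_sub hd hp i 0 1
  -- With these coefficients the product is `(ks_i - eps i) * (ks_i + eps i) = ks_i² - eps (i + 1)`.
  have hquad := fun i : Fin n => knapsackExp_mul_level_sub hd hp i 1 (eps i - #F / 2)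
  simp only [knapsackExp, LinearMap.comp_apply, AlgHom.toLinearMap_apply, map_mul]
  set E := prodExp (fun i : Fin n => (#F / 2 + eps i : ℝ)) (fun i : Fin n => (#F / 2 - eps i : ℝ)) F
  refine Fin.cases ?_ (fun i => ?_) l
  · rw [if_neg (by simp [Fin.ext_iff]; omega)]
    rw [← hlin ⟨0, hn⟩]
    congr 2
    ext Y
    rw [Q, Fin.cons_zero, map_sub, Pi.sub_apply, hks, evalFn_C]
    simp [eps]
  · by_cases hi : (i : ℕ) + 1 < n
    · rw [if_neg (by simp [Fin.ext_iff]; omega)]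
      have : evalFn O F (Q n hn i.succ) =
          (fun Y => (level F (Y i) - (#F / 2 + eps i)) *
            (1 * level F (Y i) + (eps i - #F / 2))) -
          fun Y => (level F (Y ⟨i + 1, hi⟩) - (#F / 2 + eps (i + 1))) *
            (0 * level F (Y ⟨i + 1, hi⟩) + 1) := by
        ext Y
        rw [Q, Fin.cons_succ, dif_pos hi, map_sub, map_pow]
        simp only [Pi.sub_apply, Pi.pow_apply, hks]
        rw [← eps_sq]
        ring
      rw [this, mul_sub, map_sub, hquad i, hlin ⟨i + 1, hi⟩, sub_zero]
    · have hin : (i : ℕ) + 1 = n := by omega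
      rw [if_pos (by simp [Fin.ext_iff]; omega)]
      have : evalFn O F (Q n hn i.succ) =
          (fun Y => (level F (Y i) - (#F / 2 + eps i)) *
            (1 * level F (Y i) + (eps i - #F / 2))) + eps n • 1 := by
        ext Y
        rw [Q, Fin.cons_succ, dif_neg hi, map_pow]
        simp only [Pi.add_apply, Pi.pow_apply, hks, Pi.smul_apply, Pi.one_apply, smul_eq_mul]
        rw [show eps n = eps i ^ 2 by rw [eps_sq, hin]]
        ring
      rw [this, mul_add, map_add, hquad i, zero_add, mul_smul_comm, mul_one, map_smul, smul_eq_mul]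

end

/-! ### From the pseudo-expectation to a large coefficient -/

/-- If all monomials become low-degree under a balanced restriction, then the lift of the last
constraint has huge coefficients. -/
lemma two_pow_le_sum_abs_coeff {n : ℕ} (hn : 0 < n) {O F : Finset (Fin (2 * n))} {d : ℕ}
    (hOF : Disjoint O F) (hcard : #F + 2 * #O = 2 * n) (hd : 4 * d + 2 ≤ #F)
    (π : Refutation (Q n hn)) (hr : ∀ i, IsTame O F d (π.r i)) (ht : ∀ l, IsTame O F d (π.t l)) :
    (2 : ℝ) ^ (2 ^ n) ≤ ∑ μ ∈ (π.t (Fin.last n)).support, |(π.t (Fin.last n)).coeff μ| := by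
  have hd' : (4 * d + 2 : ℝ) ≤ #F := by exact_mod_cast hd
  have hd0 : (0 : ℝ) ≤ d := Nat.cast_nonneg d
  have hid := congrArg (knapsackExp n O F) π.identity
  have hlog : ∑ a, knapsackExp n O F (π.u a * boolAxiom a + π.v a * twinAxiom a) = 0 := by
    refine sum_eq_zero fun a _ => ?_
    rw [map_add, knapsackExp_mul_of_evalFn_eq_zero _ _ (evalFn_boolAxiom O F a),
      knapsackExp_mul_of_evalFn_eq_zero _ _ (evalFn_twinAxiom O F a), add_zero]
  have hsq : 0 ≤ ∑ i, knapsackExp n O F (π.r i ^ 2) := by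
    refine sum_nonneg fun i _ => prodExp_sq_nonneg (fun _ => by ring) (by omega)
      (fun j => ?_) (fun j => ?_) (hr i)
    · have := eps_pos j; linarith
    · have := eps_le_half j; linarith
  rw [map_add, map_add, map_sum, map_sum, map_sum, hlog, map_neg, knapsackExp_one,
    sum_congr rfl fun l _ => knapsackExp_mul_Q hn hOF hcard (by omega) (ht l) l,
    sum_ite_eq' univ (Fin.last n), if_pos (mem_univ _)] at hid
  have hbound : |knapsackExp n O F (π.t (Fin.last n))| ≤ _ :=
    abs_prodExp_le (fun _ => by ring) (fun j => by have := eps_pos j; linarith)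
      (fun j => by have := eps_le_half j; linarith) (ht (Fin.last n))
  have h1 : 1 ≤ eps n * -knapsackExp n O F (π.t (Fin.last n)) := by linarith
  have h2 : (2 : ℝ) ^ (2 ^ n) * eps n = 1 := by
    rw [eps, ← mul_pow]; norm_num
  refine le_trans ?_ ((neg_le_abs _).trans hbound)
  have h3 := mul_le_mul_of_nonneg_left h1 (by positivity : (0 : ℝ) ≤ 2 ^ (2 ^ n))
  rwa [← mul_assoc, h2, one_mul, mul_one] at h3

lemma Proof.support_r_subset {ι : Type*} [Fintype ι] {m : ℕ} {q : Fin m → Poly ι} {p : Poly ι}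
    (π : Proof q p) (i : Fin π.k) : (π.r i).support ⊆ π.explicitMonomials := by
  intro μ hμ
  simp only [Proof.explicitMonomials, mem_union, mem_biUnion]
  exact Or.inl (Or.inl ⟨i, mem_univ _, hμ⟩)

lemma Proof.support_t_subset {ι : Type*} [Fintype ι] {m : ℕ} {q : Fin m → Poly ι} {p : Poly ι}
    (π : Proof q p) (l : Fin m) : (π.t l).support ⊆ π.explicitMonomials := by
  intro μ hμ
  simp only [Proof.explicitMonomials, mem_union, mem_biUnion]
  exact Or.inl (Or.inr ⟨l, mem_univ _, Or.inl hμ⟩)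

/-- A refutation with few explicit monomials has a huge coefficient. -/
lemma exists_large_coeff {n : ℕ} (hn : 0 < n) (h4 : 4 ≤ n) {s : ℝ} (hs : 0 < s)
    (hns : n * s * (3 / 4) ^ (n / 32) < 1) (π : Refutation (Q n hn))
    (hsize : (#π.explicitMonomials : ℝ) < s) :
    ∃ b : ℝ, π.HasCoeff b ∧ (2 : ℝ) ^ (2 ^ n : ℕ) / s ≤ |b| := by
  by_contra! hcoeff
  set S : Finset (Finset (Fin (2 * n)) × Finset (Fin (2 * n))) :=
    (π.explicitMonomials ×ˢ (univ : Finset (Fin n))).image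
      fun P => (posVars P.1 P.2, negVars P.1 P.2) with hS
  have hScard : (#S : ℝ) ≤ #π.explicitMonomials * n := by
    have : #S ≤ #π.explicitMonomials * n := by
      refine card_image_le.trans ?_
      rw [card_product, card_univ, Fintype.card_fin]
    exact_mod_cast this
  have hlt : (#S : ℝ) * (3 / 4) ^ (n / 32) < 1 := by
    refine lt_of_le_of_lt ?_ hns
    gcongr
    refine hScard.trans ?_
    rw [mul_comm]
    gcongr
  obtain ⟨ρ, hρ⟩ := exists_restriction S (n / 32) hlt
  have htame : ∀ p : Poly (Fin n × Fin (2 * n)), p.support ⊆ π.explicitMonomials →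
      IsTame (ones ρ) (free ρ) (4 * (n / 32)) p := fun p hp μ hμ i =>
    hρ _ (mem_image.2 ⟨(μ, i), mem_product.2 ⟨hp hμ, mem_univ _⟩, rfl⟩)
  have hcard := card_free ρ
  have hones := card_ones ρ
  have hmain := two_pow_le_sum_abs_coeff hn (disjoint_ones_free ρ) hcard
    -- At least `n` bits stay free, and `16 * (n / 32) + 2 ≤ n` because `n ≥ 4`.
    (d := 4 * (n / 32)) (by omega) π (fun i => htame _ (π.support_r_subset i))
    (fun l => htame _ (π.support_t_subset l))
  have hle : ∑ μ ∈ (π.t (Fin.last n)).support, |(π.t (Fin.last n)).coeff μ| ≤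
      #(π.t (Fin.last n)).support • ((2 : ℝ) ^ (2 ^ n : ℕ) / s) :=
    sum_le_card_nsmul _ _ _ fun μ hμ =>
      (hcoeff _ ⟨_, Or.inr (Or.inl ⟨Fin.last n, rfl⟩), μ, hμ, rfl⟩).le
  have hsupp : (#(π.t (Fin.last n)).support : ℝ) < s :=
    lt_of_le_of_lt (Nat.cast_le.2 (card_le_card (π.support_t_subset _))) hsize
  have hlt2 := mul_lt_mul_of_pos_right hsupp
    (by positivity : (0 : ℝ) < (2 : ℝ) ^ (2 ^ n : ℕ) / s)
  rw [mul_div_cancel₀ _ hs.ne'] at hlt2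
  rw [nsmul_eq_mul] at hle
  linarith

end SOS

theorem mainTheorem1 :
    ∃ c : ℝ, 0 < c ∧ ∃ N : ℕ, ∀ (n : ℕ) (hn : 0 < n), N ≤ n → ∀ π : SOS.Refutation (SOS.Q n hn),
      (2 : ℝ) ^ (c * (n : ℝ)) ≤ (π.explicitMonomials.card : ℝ) ∨
        ∃ b : ℝ, π.HasCoeff b ∧ (2 : ℝ) ^ (2 ^ n : ℕ) / (2 : ℝ) ^ (c * (n : ℝ)) ≤ |b| := by
  obtain ⟨N, hN⟩ := SOS.exists_union_bound
  refine ⟨1 / 200, by norm_num, max N 4, fun n hn hNn π => ?_⟩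
  refine (le_or_gt _ _).imp_right fun hsize => ?_
  exact SOS.exists_large_coeff hn ((le_max_right _ _).trans hNn) (by positivity)
    (hN n ((le_max_left _ _).trans hNn)) π hsize
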